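/- Let $\mathfrak C=\{0,1\}^n$ be the vertex set of the $n$-dimensional hypercube. An outmap is an arbitrary function $s\colon\mathfrak C\to\{0,1\}^n$. For $J\subseteq[n]$ and $z\in\mathfrak C$, the face $\mathfrak C_z^J$ is the set of all $v$ with $v_i=z_i$ for all $i\notin J$; a vertex $w\in\mathfrak C_z^J$ is a sink of this face if $s(w)_i=0$ for all $i\in J$. A clash is a pair of distinct vertices $u,v$ with $(s(u)\oplus s(v))\wedge(u\oplus v)=0^n$. The problem Sink-or-Clash asks, given oracle access to an outmap $s$, to find a vertex $w$ with $s(w)=0^n$ or a clash, such that all vertices of the answer have been queried. Let $t(n)=\min_{\mathcal A}\max_s t(\mathcal A,s)$, where $\mathcal A$ ranges over the deterministic query algorithms (decision trees) that solve Sink-or-Clash on every outmap of the $n$-dimensional hypercube and $t(\mathcal A,s)$ is the number of queries of $\mathcal A$ on $s$. The Adapted Fibonacci Seesaw on $(s,J,z)$ is the following recursive algorithm. If $J=\emptyset$, query $z$ and return it. Otherwise query $u=z$ and $v=z\oplus\bigvee_{i\in J}e_i$ and put $I=\emptyset$. While $|I|\le|J|-2$: let $j$ be the first element of $J\setminus I$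 with $u_j\ne v_j$ and $s(u)_j\ne s(v)_j$; if there is none, return the clash $(u,v)$; swap $u$ and $v$ if $s(u)_j=1$; call the algorithm recursively on $(s,I,v\oplus e_j)$; if it returns a clash, return that clash; otherwise it returns a vertex $w$, and if $s(w)_j=1$, return the clash $(v,w)$, else replace $v$ by $w$ and $I$ by $I\cup\{j\}$. Finally, for the only element $j$ of $J\setminus I$, return $u$ if $s(u)_j=0$, otherwise return $v$ if $s(v)_j=0$, otherwise return the clash $(u,v)$. Lemma. 1. For all $n$, $J\subseteq[n]$, $z\in\mathfrak C$ and every outmap $s$, the Adapted Fibonacci Seesaw returns a sink of the face $\mathfrak C_z^J$ or a clash inside this face, all of whose vertices it has queried, and it makes at most $C(|J|)$ queries, where $C(0)=1$ and $C(m)=2+\sum_{k=0}^{m-2}C(k)$ for $m\ge1$. In particular, with $J=[n]$ and any $z$, it solves Sink-or-Clash. 2. $t(n)\le 2+\sum_{k=0}^{n-2}t(k)$ for all $n\ge1$, and $t(n)\in O(1.62^n)$. 3. $t(n)\le 2+\sum_{k=0}^{n-5}t(k)+5\,t(n-4)$ for all $n\ge4$, and $t(n)\in O(1.61^n)$. (Empty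 sums are $0$.) -/

import Mathlib

open Asymptotics Filter

namespace SinkOrClash

/-- A bitstring of length `n`: a vertex of the `n`-dimensional hypercube, or an outmap value. -/
abbrev BitString (n : ℕ) : Type := Fin n → Bool

/-- An arbitrary outmap; it need not come from an orientation of the edges. -/
abbrev Outmap (n : ℕ) : Type := BitString n → BitString n

/-- Distinct vertices `u, v` with `(s(u) ⊕ s(v)) ∧ (u ⊕ v) = 0`. -/
def IsClash {n : ℕ} (s : Outmap n) (u v : BitString n) : Prop :=
  u ≠ v ∧ ∀ i, ((s u i ^^ s v i) && (u i ^^ v i)) = false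

/-- The vertices of the face that contains `z` and is spanned by the coordinates in `J`. -/
def face {n : ℕ} (J : Finset (Fin n)) (z : BitString n) : Set (BitString n) :=
  {v | ∀ i, i ∉ J → v i = z i}

/-- The bitstring `v ⊕ ⋁_{i ∈ J} e_i`. -/
def flip {n : ℕ} (v : BitString n) (J : Finset (Fin n)) : BitString n :=
  fun i => v i ^^ decide (i ∈ J)

/-- Deterministic query algorithms (decision trees) on outmaps of the `n`-dimensional hypercube:
either stop and return a value, or query the outmap at a vertex `v` and continue according to
the outmap value received. -/
inductive QueryAlgorithm (n : ℕ) (α : Type) : Type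
  | ret (a : α) : QueryAlgorithm n α
  | query (v : BitString n) (next : BitString n → QueryAlgorithm n α) : QueryAlgorithm n α

namespace QueryAlgorithm

variable {n : ℕ} {α β : Type}

/-- The value returned when the oracle answers according to `s`. -/
def output (s : Outmap n) : QueryAlgorithm n α → α
  | ret a => a
  | query v next => output s (next (s v))

/-- The vertices queried, in order, when the oracle answers according to `s`. -/
def queried (s : Outmap n) : QueryAlgorithm n α → List (BitString n)
  | ret _ => []
  | query v next => v :: queried s (next (s v))

/-- The number of queries on the outmap `s`. -/
def queryCount (A : QueryAlgorithm n α) (s : Outmap n) : ℕ := (A.queried s).length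

/-- Run the first algorithm, then continue with the second one, given the value returned. -/
def bind : QueryAlgorithm n α → (α → QueryAlgorithm n β) → QueryAlgorithm n β
  | ret a, f => f a
  | query v next, f => query v (fun a => bind (next a) f)

end QueryAlgorithm

/-- What a search may return: a vertex `w` claimed to be a sink, along with its outmap value `a`,
or two vertices claimed to clash. -/
inductive Answer (n : ℕ) : Type
  | sink (w a : BitString n) : Answer n
  | clash (u v : BitString n) : Answer n

/-- The vertices named in an answer. -/
def Answer.vertices {n : ℕ} : Answer n → Set (BitString n)
  | .sink w _ => {w}
  | .clash u v => {u, v}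

/-- The claim made by the answer is true, where "sink" means: sink with respect to the
coordinates in `J`. -/
def Answer.IsCorrect {n : ℕ} (s : Outmap n) (J : Finset (Fin n)) : Answer n → Prop
  | .sink w a => s w = a ∧ ∀ i ∈ J, s w i = false
  | .clash u v => IsClash s u v

/-- On every outmap, the algorithm returns a sink of the face spanned by `J` at `z`, or a clash
inside this face, and it has queried all vertices of its answer. -/
def SolvesFace {n : ℕ} (A : QueryAlgorithm n (Answer n)) (J : Finset (Fin n)) (z : BitString n) :
    Prop :=
  ∀ s : Outmap n, (A.output s).IsCorrect s J ∧
    ∀ v ∈ (A.output s).vertices, v ∈ face J z ∧ v ∈ A.queried s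

/-- The algorithm solves Sink-or-Clash: on every outmap it returns a global sink or a clash,
and it has queried all vertices of its answer. -/
def Solves {n : ℕ} (A : QueryAlgorithm n (Answer n)) : Prop :=
  ∀ s : Outmap n, (A.output s).IsCorrect s Finset.univ ∧
    ∀ v ∈ (A.output s).vertices, v ∈ A.queried s

/-- `t n`: the minimum, over all deterministic algorithms that solve Sink-or-Clash in dimension
`n`, of the maximum number of queries over all outmaps. -/
noncomputable def t (n : ℕ) : ℕ :=
  sInf {m : ℕ | ∃ A : QueryAlgorithm n (Answer n), Solves A ∧
    (Finset.univ.sup fun s : Outmap n => A.queryCount s) = m}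

mutual

/-- The adapted Fibonacci Seesaw on the face spanned by `J` at `z`. -/
def seesaw {n : ℕ} (J : Finset (Fin n)) (z : BitString n) : QueryAlgorithm n (Answer n) :=
  if J = ∅ then
    .query z fun a => .ret (.sink z a)
  else
    .query z fun a => .query (flip z J) fun b => seesawLoop J ∅ (z, a) (flip z J, b)
termination_by (J.card, J.card + 1)
decreasing_by
  exact Prod.Lex.right _ (by simp)

/-- The loop of the adapted Fibonacci Seesaw. The pairs `p = (u, s(u))` and `q = (v, s(v))` hold
sinks `u`, `v` of two antipodal faces (of the face spanned by `J`) that are spanned by `I`. -/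
def seesawLoop {n : ℕ} (J I : Finset (Fin n)) (p q : BitString n × BitString n) :
    QueryAlgorithm n (Answer n) :=
  if I.card + 1 < J.card then
    -- the coordinates that witness that `u` and `v` do not clash
    let D := (J \ I).filter fun i => ((p.1 i ^^ q.1 i) && (p.2 i ^^ q.2 i)) = true
    if hD : D.Nonempty then
      let j := D.min' hD
      -- swap, if necessary, such that `s(u)_j = 0` and `s(v)_j = 1`
      let p' := if p.2 j then q else p
      let q' := if p.2 j then p else q
      (seesaw I (flip q'.1 {j})).bind fun
        | .clash x y => .ret (.clash x y)
        | .sink w a =>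
          if a j then .ret (.clash q'.1 w)
          else seesawLoop J (insert j I) p' (w, a)
    else .ret (.clash p.1 q.1)
  else
    -- a single coordinate of `J` is left
    if ∀ i ∈ J \ I, p.2 i = false then .ret (.sink p.1 p.2)
    else if ∀ i ∈ J \ I, q.2 i = false then .ret (.sink q.1 q.2)
    else .ret (.clash p.1 q.1)
termination_by (J.card, J.card - I.card)
decreasing_by
  · exact Prod.Lex.left _ _ (by omega)
  · have hI : D.min' hD ∉ I :=
      (Finset.mem_sdiff.1 (Finset.mem_filter.1 (Finset.min'_mem D hD)).1).2
    have hc : (insert (D.min' hD) I).card = I.card + 1 := Finset.card_insert_of_notMem hI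
    exact Prod.Lex.right _ (hc.symm ▸ by omega)

end

/-- The number of queries that the recursive algorithm is allowed on an `m`-dimensional face: one
query for `m = 0`; otherwise two queries and recursive calls in dimensions `0, …, m - 2`. -/
def seesawCost : ℕ → ℕ
  | 0 => 1
  | m + 1 => 2 + ∑ k : Fin m, seesawCost k

end SinkOrClash

open SinkOrClash

-- Suppose two antipodal faces spanned by `I` have known sinks `u`, `v`. Both outmap values vanish
-- on `I`, so unless `u`, `v` clash, some `j ∉ I` has, up to a swap, `s(u)_j = 0` and `s(v)_j = 1`.
-- Search the neighbouring face at `v ⊕ e_j` for a sink `w`. If `s(w)_j = 1`, then `v` and `w`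
-- clash; otherwise `u` and `w` are sinks of antipodal faces spanned by `I ∪ {j}`. Growing `I` from
-- `∅` costs one search per dimension, and the last coordinate is free. `SeesawState.finds_step` is
-- this step for the concrete algorithm, `Antipodal.step` for the bounds on `t`.
--
-- For the bounds, decision trees are replaced by the predicate `Reaches` on histories, where
-- strategies compose easily (`Reaches.bind`). Contracting the faces spanned by `I` to points, each
-- carrying the outmap value of a sink found in it, yields a smaller cube; a sink or clash there
-- lifts back (`Inherits.settled`). So a strategy for the small cube can be run with searches as
-- queries (`Reaches.inherit`).
--
-- For the improved recursion the seesaw stops with four coordinates left. The contracted 4-cube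
-- then has two known antipodal values, and a kernel-checked table of strategies finishes with five
-- queries. The rate 1.61 comes from this recursion, and the rate 1.62 follows from it.

namespace SinkOrClash

-- Histories and strategies

/-- The answers received so far: pairs of a vertex and its outmap value. -/
abbrev History (n : ℕ) : Type := List (BitString n × BitString n)

/-- No vertex occurs in the history with two different outmap values. -/
def Consistent {n : ℕ} (H : History n) : Prop :=
  ∀ p ∈ H, ∀ q ∈ H, p.1 = q.1 → p.2 = q.2

/-- The outmap `s` gives the answers in the history. -/
def Agrees {n : ℕ} (s : Outmap n) (H : History n) : Prop :=
  ∀ p ∈ H, s p.1 = p.2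

/-- The history contains a sink of the face spanned by `J` at `z`. -/
def HasSink {n : ℕ} (J : Finset (Fin n)) (z : BitString n) (H : History n) : Prop :=
  ∃ p ∈ H, p.1 ∈ face J z ∧ ∀ i ∈ J, p.2 i = false

/-- The history contains two clashing vertices. -/
def HasClash {n : ℕ} (H : History n) : Prop :=
  ∃ p ∈ H, ∃ q ∈ H, p.1 ≠ q.1 ∧ ∀ i, ((p.2 i ^^ q.2 i) && (p.1 i ^^ q.1 i)) = false

/-- The history contains a sink of the face or a clash, unless no outmap agrees with it. -/
def Settled {n : ℕ} (J : Finset (Fin n)) (z : BitString n) (H : History n) : Prop :=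
  Consistent H → HasSink J z H ∨ HasClash H

/-- From the history `H`, at most `k` queries suffice to reach a history in `G`, whatever the
outmap values received. -/
def Reaches {n : ℕ} (G : History n → Prop) : ℕ → History n → Prop
  | 0, H => G H
  | k + 1, H => G H ∨ ∃ v, ∀ a, Reaches G k ((v, a) :: H)

variable {n : ℕ}

theorem Agrees.consistent {s : Outmap n} {H : History n} (h : Agrees s H) : Consistent H := by
  intro p hp q hq hpq
  rw [← h p hp, ← h q hq, hpq]

theorem Agrees.cons {s : Outmap n} {H : History n} (h : Agrees s H) (v : BitString n) :
    Agrees s ((v, s v) :: H) := by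
  intro p hp
  rcases List.mem_cons.1 hp with rfl | hp
  · rfl
  · exact h p hp

theorem Consistent.exists_agrees {H : History n} (h : Consistent H) : ∃ s, Agrees s H := by
  classical
  -- The value off the history is arbitrary; `v` is just a bitstring at hand.
  refine ⟨fun v => if hv : ∃ a, (v, a) ∈ H then hv.choose else v, fun p hp => ?_⟩
  have hv : ∃ a, (p.1, a) ∈ H := ⟨p.2, hp⟩
  simp only [dif_pos hv]
  exact h _ hv.choose_spec p hp rfl

theorem Reaches.of_goal {G : History n → Prop} {H : History n} (h : G H) :
    ∀ k, Reaches G k H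
  | 0 => h
  | _ + 1 => Or.inl h

theorem Reaches.mono {G : History n → Prop} {k l : ℕ} (hkl : k ≤ l) :
    ∀ {H : History n}, Reaches G k H → Reaches G l H := by
  induction k generalizing l with
  | zero => exact fun h => Reaches.of_goal h l
  | succ k ih =>
    intro H h
    obtain ⟨l, rfl⟩ : ∃ m, l = m + 1 := ⟨l - 1, by omega⟩
    rcases h with h | ⟨v, hv⟩
    · exact Or.inl h
    · exact Or.inr ⟨v, fun a => ih (by omega) (hv a)⟩

/-- Budgets add up. The inclusion `H ⊆ H'` lets the second phase reuse vertices known before the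
first. -/
theorem Reaches.bind {G G' : History n → Prop} {k l : ℕ} {H : History n} (h : Reaches G k H)
    (hG : ∀ H', H ⊆ H' → G H' → Reaches G' l H') : Reaches G' (k + l) H := by
  induction k generalizing H with
  | zero => simpa using hG H (List.Subset.refl H) h
  | succ k ih =>
    rcases h with h | ⟨v, hv⟩
    · exact (hG H (List.Subset.refl H) h).mono (by omega)
    · have : Reaches G' (k + l + 1) H :=
        Or.inr ⟨v, fun a => ih (hv a) fun H' hH' =>
          hG H' (fun p hp => hH' (List.mem_cons_of_mem _ hp))⟩
      rwa [show k + 1 + l = k + l + 1 by omega]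

-- Decision trees versus histories

/-- A decision tree that settles every outmap is a strategy in terms of histories. -/
theorem reaches_of_queryAlgorithm {z : BitString n} {k : ℕ} (A : QueryAlgorithm n (Answer n)) :
    ∀ {H : History n}, (∀ s, Agrees s H → A.queryCount s ≤ k ∧
      (A.output s).IsCorrect s Finset.univ ∧
      ∀ v ∈ (A.output s).vertices, v ∈ A.queried s ∨ ∃ a, (v, a) ∈ H) →
    Reaches (Settled Finset.univ z) k H := by
  induction A generalizing k with
  | ret a =>
    intro H h
    refine Reaches.of_goal (fun hc => ?_) k
    obtain ⟨s, hs⟩ := hc.exists_agrees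
    obtain ⟨-, hcor, hv⟩ := h s hs
    cases a with
    | sink w b =>
      obtain ⟨a, ha⟩ : ∃ a, (w, a) ∈ H := by
        simpa [QueryAlgorithm.queried] using hv w (by simp [QueryAlgorithm.output, Answer.vertices])
      refine Or.inl ⟨(w, a), ha, fun i hi => absurd (Finset.mem_univ i) hi, fun i hi => ?_⟩
      rw [← hs _ ha]
      exact hcor.2 i hi
    | clash x y =>
      obtain ⟨a, ha⟩ : ∃ a, (x, a) ∈ H := by
        simpa [QueryAlgorithm.queried] using hv x (by simp [QueryAlgorithm.output, Answer.vertices])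
      obtain ⟨b, hb⟩ : ∃ a, (y, a) ∈ H := by
        simpa [QueryAlgorithm.queried] using hv y (by simp [QueryAlgorithm.output, Answer.vertices])
      refine Or.inr ⟨_, ha, _, hb, hcor.1, ?_⟩
      rw [← hs _ ha, ← hs _ hb]
      exact hcor.2
  | query v next ih =>
    intro H h
    -- An agreeing outmap is needed to see that the budget is positive; for inconsistent `H` the
    -- goal is vacuous.
    by_cases hc : Consistent H
    · obtain ⟨s, hs⟩ := hc.exists_agrees
      have h1 := (h s hs).1
      simp only [QueryAlgorithm.queryCount, QueryAlgorithm.queried, List.length_cons] at h1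
      obtain ⟨k, rfl⟩ : ∃ m, k = m + 1 := ⟨k - 1, by omega⟩
      refine Or.inr ⟨v, fun a => ih a fun s hs' => ?_⟩
      have hva : s v = a := hs' (v, a) (by simp)
      obtain ⟨h1, h2, h3⟩ := h s fun p hp => hs' p (by simp [hp])
      simp only [QueryAlgorithm.queryCount, QueryAlgorithm.queried, QueryAlgorithm.output,
        List.length_cons, hva, List.mem_cons] at h1 h2 h3
      refine ⟨by simpa [QueryAlgorithm.queryCount] using h1, h2, fun x hx => ?_⟩
      rcases h3 x hx with (rfl | h3) | ⟨b, hb⟩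
      · exact Or.inr ⟨a, by simp⟩
      · exact Or.inl h3
      · exact Or.inr ⟨b, by simp [hb]⟩
    · exact Reaches.of_goal (fun hc' => absurd hc' hc) k

/-- A strategy in terms of histories yields a decision tree. -/
theorem exists_queryAlgorithm_of_reaches {z : BitString n} {k : ℕ} {H : History n}
    (h : Reaches (Settled Finset.univ z) k H) :
    ∃ A : QueryAlgorithm n (Answer n), ∀ s, Agrees s H → A.queryCount s ≤ k ∧
      (A.output s).IsCorrect s Finset.univ ∧
      ∀ v ∈ (A.output s).vertices, v ∈ A.queried s ∨ ∃ a, (v, a) ∈ H := by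
  have settled : ∀ {k : ℕ} {H : History n}, Settled Finset.univ z H →
      ∃ A : QueryAlgorithm n (Answer n), ∀ s, Agrees s H → A.queryCount s ≤ k ∧
        (A.output s).IsCorrect s Finset.univ ∧
        ∀ v ∈ (A.output s).vertices, v ∈ A.queried s ∨ ∃ a, (v, a) ∈ H := by
    intro k H h
    by_cases hc : Consistent H
    · rcases h hc with ⟨p, hp, -, hs⟩ | ⟨p, hp, q, hq, hne, hs⟩
      · refine ⟨.ret (.sink p.1 p.2), fun s hsH => ?_⟩
        simp only [QueryAlgorithm.queryCount, QueryAlgorithm.queried, QueryAlgorithm.output,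
          Answer.IsCorrect, Answer.vertices, hsH p hp]
        refine ⟨by simp, ⟨trivial, hs⟩, ?_⟩
        rintro v rfl
        exact Or.inr ⟨_, hp⟩
      · refine ⟨.ret (.clash p.1 q.1), fun s hsH => ?_⟩
        simp only [QueryAlgorithm.queryCount, QueryAlgorithm.queried, QueryAlgorithm.output,
          Answer.IsCorrect, Answer.vertices, IsClash, hsH p hp, hsH q hq]
        refine ⟨by simp, ⟨hne, hs⟩, ?_⟩
        rintro v (rfl | rfl)
        · exact Or.inr ⟨_, hp⟩
        · exact Or.inr ⟨_, hq⟩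
    · exact ⟨.ret (.clash z z), fun s hs => absurd hs.consistent hc⟩
  induction k generalizing H with
  | zero => exact settled h
  | succ k ih =>
    rcases h with h | ⟨v, hv⟩
    · exact settled h
    · choose next hnext using fun a => ih (hv a)
      refine ⟨.query v next, fun s hs => ?_⟩
      obtain ⟨h1, h2, h3⟩ := hnext (s v) s (hs.cons v)
      simp only [QueryAlgorithm.queryCount, QueryAlgorithm.queried, QueryAlgorithm.output,
        List.length_cons, List.mem_cons] at h1 h2 h3 ⊢
      refine ⟨by omega, h2, fun x hx => ?_⟩
      rcases h3 x hx with h3 | ⟨b, h3 | h3⟩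
      · exact Or.inl (Or.inr h3)
      · exact Or.inl (Or.inl (congrArg Prod.fst h3))
      · exact Or.inr ⟨b, h3⟩

-- Inherited outmaps on contracted cubes

/-- The vertex that arises from `z` by flipping the coordinates `e j` with `x j = true`. -/
def shift {d : ℕ} (e : Fin d ↪ Fin n) (z : BitString n) (x : BitString d) : BitString n :=
  fun i => z i ^^ decide (∃ j, e j = i ∧ x j = true)

theorem shift_apply {d : ℕ} (e : Fin d ↪ Fin n) (z : BitString n) (x : BitString d) (j : Fin d) :
    shift e z x (e j) = (z (e j) ^^ x j) := by
  simp [shift]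

theorem shift_of_notMem {d : ℕ} (e : Fin d ↪ Fin n) (z : BitString n) (x : BitString d)
    {i : Fin n} (hi : ∀ j, e j ≠ i) : shift e z x i = z i := by
  simp [shift, hi]

/-- The history `H'` contains, for each pair in `H`, a sink of the corresponding face spanned by
`I`, whose outmap value restricts to the given one. -/
def Inherits {d : ℕ} (e : Fin d ↪ Fin n) (I : Finset (Fin n)) (z : BitString n) (H : History d)
    (H' : History n) : Prop :=
  ∀ p ∈ H, ∃ q ∈ H', q.1 ∈ face I (shift e z p.1) ∧ (∀ i ∈ I, q.2 i = false) ∧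
    ∀ j, q.2 (e j) = p.2 j

/-- Sinks of faces spanned by `I` have equal outmap values on `I`, and as vertices they agree
outside `I` and the range of `e`. Hence only the coordinates `e j` decide whether two of them clash.
-/
theorem Inherits.settled {d : ℕ} {e : Fin d ↪ Fin n} {I : Finset (Fin n)} {z : BitString n}
    {y : BitString d} {H : History d} {H' : History n} (he : ∀ j, e j ∉ I)
    (hH : Inherits e I z H H') (h : Settled Finset.univ y H) :
    Settled (I ∪ Finset.univ.map e) z H' := by
  intro hc'
  by_cases hcl : HasClash H'
  · exact Or.inr hcl
  -- Conflicting values at one contracted vertex come from two distinct sinks of the same face,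
  -- which clash.
  have hc : Consistent H := by
    intro p hp p' hp' hpp
    obtain ⟨q, hq, hqf, hqI, hqe⟩ := hH p hp
    obtain ⟨q', hq', hqf', hqI', hqe'⟩ := hH p' hp'
    rcases eq_or_ne q.1 q'.1 with heq | hne
    · funext j
      rw [← hqe, ← hqe', hc' q hq q' hq' heq]
    · refine absurd ⟨q, hq, q', hq', hne, fun i => ?_⟩ hcl
      by_cases hi : i ∈ I
      · simp [hqI i hi, hqI' i hi]
      · simp [hqf i hi, hqf' i hi, hpp]
  rcases h hc with ⟨p, hp, -, hs⟩ | ⟨p, hp, p', hp', hne, hcl'⟩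
  · obtain ⟨q, hq, hqf, hqI, hqe⟩ := hH p hp
    refine Or.inl ⟨q, hq, fun i hi => ?_, fun i hi => ?_⟩
    · simp only [Finset.mem_union, Finset.mem_map, Finset.mem_univ, true_and, not_or,
        not_exists] at hi
      rw [hqf i hi.1, shift_of_notMem e z _ hi.2]
    · simp only [Finset.mem_union, Finset.mem_map, Finset.mem_univ, true_and] at hi
      rcases hi with hi | ⟨j, rfl⟩
      · exact hqI i hi
      · rw [hqe, hs j (Finset.mem_univ j)]
  · obtain ⟨q, hq, hqf, hqI, hqe⟩ := hH p hp
    obtain ⟨q', hq', hqf', hqI', hqe'⟩ := hH p' hp'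
    refine Or.inr ⟨q, hq, q', hq', fun heq => hne (funext fun j => ?_), fun i => ?_⟩
    · have := congrFun heq (e j)
      rw [hqf _ (he j), hqf' _ (he j), shift_apply, shift_apply] at this
      simpa using this
    · by_cases hi : i ∈ I
      · simp [hqI i hi, hqI' i hi]
      · rw [hqf i hi, hqf' i hi]
        by_cases hj : ∃ j, e j = i
        · obtain ⟨j, rfl⟩ := hj
          have := hcl' j
          rw [hqe, hqe', shift_apply, shift_apply]
          revert this
          cases p.2 j <;> cases p'.2 j <;> cases p.1 j <;> cases p'.1 j <;> cases z (e j) <;> simp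
        · push Not at hj
          simp [shift_of_notMem e z _ hj]

/-- A strategy for the `d`-dimensional cube applies to the outmap inherited by the faces spanned
by `I`, where each query is replaced by a search in such a face. -/
theorem Reaches.inherit {d c k : ℕ} {e : Fin d ↪ Fin n} {I : Finset (Fin n)} {z : BitString n}
    {y : BitString d} (he : ∀ j, e j ∉ I)
    (hI : ∀ (x : BitString n) (H : History n), Reaches (Settled I x) c H) {H : History d}
    {H' : History n} (hH : Inherits e I z H H') (h : Reaches (Settled Finset.univ y) k H) :
    Reaches (Settled (I ∪ Finset.univ.map e) z) (c * k) H' := by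
  induction k generalizing H H' with
  | zero => exact hH.settled he h
  | succ k ih =>
    rcases h with h | ⟨v, hv⟩
    · exact Reaches.of_goal (hH.settled he h) _
    rw [Nat.mul_succ, Nat.add_comm]
    refine (hI (shift e z v) H').bind fun H'' hsub hset => ?_
    by_cases hc : Consistent H''
    swap
    · exact Reaches.of_goal (fun hc' => absurd hc' hc) _
    rcases hset hc with ⟨q, hq, hqf, hqs⟩ | hcl
    · refine ih (H := (v, fun j => q.2 (e j)) :: H) (fun p hp => ?_) (hv _)
      rcases List.mem_cons.1 hp with rfl | hp
      · exact ⟨q, hq, hqf, hqs, fun j => rfl⟩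
      · obtain ⟨r, hr, hr'⟩ := hH p hp
        exact ⟨r, hsub hr, hr'⟩
    · exact Reaches.of_goal (fun _ => Or.inr hcl) _

-- The seesaw step

/-- The history contains sinks of two antipodal faces spanned by `I`. -/
def Antipodal (I : Finset (Fin n)) (H : History n) : Prop :=
  ∃ p ∈ H, ∃ q ∈ H, (∀ i ∉ I, q.1 i = !p.1 i) ∧ ∀ i ∈ I, p.2 i = false ∧ q.2 i = false

/-- If the two antipodal sinks do not clash, then some coordinate tells them apart. -/
theorem Antipodal.exists_coordinate {I : Finset (Fin n)} {H : History n} (h : Antipodal I H)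
    (hI : I.card < n) (hcl : ¬ HasClash H) :
    ∃ j ∉ I, ∃ p ∈ H, ∃ q ∈ H, (∀ i ∉ I, q.1 i = !p.1 i) ∧
      (∀ i ∈ I, p.2 i = false ∧ q.2 i = false) ∧ p.2 j = false ∧ q.2 j = true := by
  obtain ⟨p, hp, q, hq, hpq, hs⟩ := h
  obtain ⟨i, hi⟩ : ∃ i, i ∉ I := by
    by_contra! hall
    have : I = Finset.univ := Finset.eq_univ_of_forall hall
    simp [this] at hI
  have hne : p.1 ≠ q.1 := fun h => by
    have := hpq i hi
    simp [h] at this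
  obtain ⟨j, hj⟩ : ∃ j, ((p.2 j ^^ q.2 j) && (p.1 j ^^ q.1 j)) ≠ false := by
    by_contra! hall
    exact hcl ⟨p, hp, q, hq, hne, hall⟩
  have hjI : j ∉ I := fun hjI => by simp [hs j hjI] at hj
  refine ⟨j, hjI, ?_⟩
  cases hpj : p.2 j
  · exact ⟨p, hp, q, hq, hpq, hs, hpj, by simpa [hpj, hpq j hjI] using hj⟩
  · refine ⟨q, hq, p, hp, fun i hi => by simp [hpq i hi], fun i hi => (hs i hi).symm, ?_, hpj⟩
    simpa [hpj, hpq j hjI] using hj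

/-- A step of the Fibonacci Seesaw. -/
theorem Antipodal.step {I : Finset (Fin n)} {H : History n} {z : BitString n} {c m : ℕ}
    (h : Antipodal I H) (hI : I.card < n)
    (hc : ∀ (x : BitString n) (H : History n), Reaches (Settled I x) c H)
    (hnext : ∀ (j : Fin n) (H' : History n), j ∉ I → Antipodal (insert j I) H' →
      Reaches (Settled Finset.univ z) m H') :
    Reaches (Settled Finset.univ z) (c + m) H := by
  by_cases hcl : HasClash H
  · exact Reaches.of_goal (fun _ => Or.inr hcl) _
  obtain ⟨j, hj, p, hp, q, hq, hpq, hs, hpj, hqj⟩ := h.exists_coordinate hI hcl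
  refine (hc (flip q.1 {j}) H).bind fun H' hsub hset => ?_
  by_cases hcons : Consistent H'
  swap
  · exact Reaches.of_goal (fun hc' => absurd hc' hcons) _
  rcases hset hcons with ⟨r, hr, hrf, hrs⟩ | hcl
  swap
  · exact Reaches.of_goal (fun _ => Or.inr hcl) _
  have hrq : ∀ i ∉ I, i ≠ j → r.1 i = q.1 i := fun i hi hij => by
    rw [hrf i hi]; simp [flip, hij]
  have hrj : r.1 j = !q.1 j := by rw [hrf j hj]; simp [flip]
  -- Value 0 at `j` makes `r` the new partner of `p`; value 1 makes it clash with `q`, from which it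
  -- differs only within `I ∪ {j}`.
  cases hr2 : r.2 j
  · refine hnext j H' hj ⟨p, hsub hp, r, hr, fun i hi => ?_, fun i hi => ?_⟩
    · simp only [Finset.mem_insert, not_or] at hi
      rw [hrq i hi.2 hi.1, hpq i hi.2]
    · rcases Finset.mem_insert.1 hi with rfl | hi
      · exact ⟨hpj, hr2⟩
      · exact ⟨(hs i hi).1, hrs i hi⟩
  · refine Reaches.of_goal (fun _ => Or.inr ⟨q, hsub hq, r, hr, fun h => ?_, fun i => ?_⟩) _
    · simp [← h] at hrj
    · by_cases hi : i ∈ I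
      · simp [(hs i hi).2, hrs i hi]
      · rcases eq_or_ne i j with rfl | hij
        · simp [hqj, hr2]
        · simp [hrq i hi hij]

-- Recursive bounds on `t`

theorem Solves.reaches {A : QueryAlgorithm n (Answer n)} (hA : Solves A) (z : BitString n) :
    Reaches (Settled Finset.univ z) (Finset.univ.sup fun s : Outmap n => A.queryCount s) [] :=
  reaches_of_queryAlgorithm A fun s _ =>
    ⟨Finset.le_sup (f := fun s : Outmap n => A.queryCount s) (Finset.mem_univ s), (hA s).1,
      fun v hv => Or.inl ((hA s).2 v hv)⟩

theorem t_le_of_reaches {z : BitString n} {k : ℕ} (h : Reaches (Settled Finset.univ z) k []) :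
    t n ≤ k := by
  obtain ⟨A, hA⟩ := exists_queryAlgorithm_of_reaches h
  have hA' := fun s => hA s fun p hp => absurd hp List.not_mem_nil
  have hsol : Solves A := fun s =>
    ⟨(hA' s).2.1, fun v hv => ((hA' s).2.2 v hv).resolve_right fun ⟨_, ha⟩ =>
      List.not_mem_nil ha⟩
  refine le_trans (b := Finset.univ.sup fun s : Outmap n => A.queryCount s) ?_
    (Finset.sup_le fun s _ => (hA' s).1)
  exact Nat.sInf_le ⟨A, hsol, rfl⟩

/-- The solver `A` serves only to make the set in the definition of `t` nonempty, so that its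
infimum is attained. -/
theorem reaches_t {A : QueryAlgorithm n (Answer n)} (hA : Solves A) (z : BitString n) :
    Reaches (Settled Finset.univ z) (t n) [] := by
  obtain ⟨B, hB, hBt⟩ := Nat.sInf_mem
    (s := {m : ℕ | ∃ A : QueryAlgorithm n (Answer n), Solves A ∧
      (Finset.univ.sup fun s : Outmap n => A.queryCount s) = m}) ⟨_, A, hA, rfl⟩
  have := hB.reaches z
  rwa [hBt] at this

/-- In a face spanned by `I`, a sink or a clash can be found with `t |I|` queries. -/
theorem reaches_face (hsol : ∀ d : ℕ, ∃ A : QueryAlgorithm d (Answer d), Solves A)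
    (I : Finset (Fin n)) (x : BitString n) (H : History n) :
    Reaches (Settled I x) (t I.card) H := by
  obtain ⟨A, hA⟩ := hsol I.card
  -- Zero-dimensional faces cost one query, so inheritance with `I = ∅` embeds a cube as a face.
  have h1 : ∀ (x : BitString n) (H : History n), Reaches (Settled ∅ x) 1 H := fun x H =>
    Or.inr ⟨x, fun a _ => Or.inl ⟨(x, a), by simp, fun _ _ => rfl, by simp⟩⟩
  have := Reaches.inherit (e := (I.orderEmbOfFin rfl).toEmbedding) (I := ∅) (z := x) (H' := H)
    (fun j => Finset.notMem_empty _) h1 (fun p hp => absurd hp List.not_mem_nil)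
    (reaches_t hA fun _ => false)
  have hmap : Finset.univ.map (I.orderEmbOfFin rfl).toEmbedding = I := by
    ext i
    simp
  rwa [one_mul, Finset.empty_union, hmap] at this

/-- The loop of the Fibonacci Seesaw, up to faces of dimension `m`. -/
theorem Antipodal.reaches (hsol : ∀ d : ℕ, ∃ A : QueryAlgorithm d (Answer d), Solves A)
    {z : BitString n} {m c : ℕ} (hm : m ≤ n)
    (hend : ∀ (I : Finset (Fin n)) (H : History n), I.card = m → Antipodal I H →
      Reaches (Settled Finset.univ z) c H)
    (I : Finset (Fin n)) (H : History n) (hI : I.card ≤ m) (h : Antipodal I H) :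
    Reaches (Settled Finset.univ z) ((∑ k ∈ Finset.Ico I.card m, t k) + c) H := by
  induction hd : m - I.card generalizing I H with
  | zero =>
    have : I.card = m := by omega
    simpa [this] using hend I H this h
  | succ d ih =>
    rw [Finset.sum_eq_sum_Ico_succ_bot (by omega), add_assoc]
    refine h.step (by omega) (reaches_face hsol I) fun j H' hj hA => ?_
    have hcard := Finset.card_insert_of_notMem hj
    rw [← hcard]
    exact ih (insert j I) H' (by omega) hA (by omega)

/-- The 2 pays for two antipodal vertices, which are sinks of their faces spanned by `∅`. -/
theorem t_le_of_antipodal (hsol : ∀ d : ℕ, ∃ A : QueryAlgorithm d (Answer d), Solves A)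
    {z : BitString n} {m c : ℕ} (hm : m ≤ n)
    (hend : ∀ (I : Finset (Fin n)) (H : History n), I.card = m → Antipodal I H →
      Reaches (Settled Finset.univ z) c H) :
    t n ≤ 2 + (∑ k ∈ Finset.range m, t k) + c := by
  refine t_le_of_reaches (z := z) ?_
  have : Reaches (Settled Finset.univ z) ((∑ k ∈ Finset.range m, t k) + c + 1 + 1) [] := by
    refine Or.inr ⟨fun _ => false, fun a => Or.inr ⟨fun _ => true, fun b => ?_⟩⟩
    have h := Antipodal.reaches hsol hm hend ∅ [(fun _ => true, b), (fun _ => false, a)]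
      (by simp) ⟨(fun _ => false, a), by simp, (fun _ => true, b), by simp, by simp, by simp⟩
    simpa using h
  exact this.mono (by omega)

/-- Once `I` misses a single coordinate, that coordinate must tell the two sinks apart, and the one
with value 0 there is a global sink. No query remains to be made. -/
theorem t_le_fibonacci (hsol : ∀ d : ℕ, ∃ A : QueryAlgorithm d (Answer d), Solves A)
    (hn : 1 ≤ n) : t n ≤ 2 + ∑ k ∈ Finset.range (n - 1), t k := by
  refine t_le_of_antipodal hsol (z := fun _ => false) (c := 0) (by omega) fun I H hI hA => ?_
  by_cases hcl : HasClash H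
  · exact Reaches.of_goal (fun _ => Or.inr hcl) _
  obtain ⟨j, hj, p, hp, q, hq, hpq, hs, hpj, -⟩ := hA.exists_coordinate (by omega) hcl
  have huniv : insert j I = Finset.univ := by
    rw [← Finset.card_eq_iff_eq_univ, Finset.card_insert_of_notMem hj, Fintype.card_fin]
    omega
  refine Reaches.of_goal (fun _ => Or.inl ⟨p, hp, by simp [face], fun i _ => ?_⟩) _
  have hi : i ∈ insert j I := huniv ▸ Finset.mem_univ i
  rcases Finset.mem_insert.1 hi with rfl | hi
  · exact hpj
  · exact (hs i hi).1

-- Verified strategies for the four-dimensional cube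

/-- The bitstring whose `i`-th entry is the `i`-th binary digit of `x`. -/
def bits (n x : ℕ) : BitString n := fun i => x.testBit i

/-- Checks that `c` encodes a strategy for the four-dimensional cube that needs at most `k` queries
when the pairs in `H` are known. Vertices and outmap values are bitstrings read as binary numbers,
and `c` encodes the list of the vertices queried, in depth-first order over the answers that are
neither sinks nor clash with an earlier one: `16 * c + v + 1` stands for `v` followed by `c`.
Returns what remains of `c`. -/
def checkStrategy : ℕ → List (ℕ × ℕ) → ℕ → Option ℕ
  | 0, _, _ => none
  | k + 1, H, c =>
    match c with
    | 0 => none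
    -- The answer 0 is omitted, being a sink.
    | c + 1 => (List.range' 1 15).foldlM (fun c' a =>
        if H.any fun p => p.1 != c % 16 && (a ^^^ p.2) &&& ((c % 16) ^^^ p.1) == 0 then some c'
        else checkStrategy k ((c % 16, a) :: H) c') (c / 16)

/-- Outmap values `a`, `b` at two antipodal vertices, and a strategy for this case. -/
def strategies : List (ℕ × ℕ × ℕ) :=
  [(15, 14, 0x5eeeedeeeeeed22555d622256ee56ee56665999beee6eee6dd66566665ddd5eddd5ccccb9ccccccbddd5b9accccb77753e2eedb739e2eeeed33327c2999dcbccccb73db927d3aaadebcceeeedcaddeaaaebcbbcceca922ee9eedeeeeeed999da5557ee9aee9aaa9eeeaeeeaddaa9aaaa9ddd9e2229addd98888758888887ddd9756e2eedb735eee2eedbbb988887383332b5552d87b888873b2dd753666de78eeeed886dde666e78778e8865229a229a562259d622562259da229a59debdb9ba7d757634),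
   (15, 12, 0xaaaa96666544443225639b42563425639ba29a5639bc29a3574bbbb9777754444232357435729ab29a39b57c29a34239b4234239ba29a39bc29a22c3339b5762229a563339b578),
   (15, 8, 0x2563423574234235762563578),
   (14, 15, 0xcecca333343333334f99e99a999999afeeeadfffed99ed999d99edeedccc4999dadadeddddeaaae94aaaecbeeeca555565555556ff999c9a999999acccab99cb999beee699cbccb999bababcbbbbcaaac9fffcb6aaacedffedffedcbffedcaffedeffcbaffcbeca933e8886334c8ccac888633433334684589989ac999899a4ac64a8bbba943bbb943443bb3bb3a9aa9339bc555c888456eee8a5c88845645555683689989ae999989a46a6ae8ddda965ddd965665dd5dd5a9aa9559de44ac4b66ae6d87),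
   (14, 13, 0x33334ac3333334ffffda9ffffffdd4ac9da94acbbabcd65fbbbbcd65fffd65ffccabffcbcca9babcdfbbbbcdfddfffccabffcbcca9bba94683bbbb94683443683399ab99a339bcbba943bbbb9434433399ab99a339bcdda9db468468468a42c5dda9db6544ac4b687),
   (14, 9, 0xddbb9bbbb9dddd9f43ddbb9bbbb9dddd9f65ddbb9bbbb9dddd9fbbbb94683bbbb943dddd94685dddd9654687),
   (14, 1, 0x39b57359d7357359db39b59df),
   (12, 15, 0x77778bbbbcddddeff87ecadfed87f87ecabfcb87eca9fcbe86d66668aaaacddddfefed86e86fcbafcbeca869fedcbfedcafedefcbafcbeca9eecae9fffcb876fffcb87eeeca865),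
   (12, 11, 0x6767877778666685bf6767877778666685ae676787777866668577778bfa9b66668ae9ba977778bf66668aed),
   (12, 3, 0x7bf6576ae57657bfa9b6ae9ba97bf6aed),
   (8, 15, 0xfedcbfedcafedefcbafcbeca9),
   (8, 7, 0xfedcbfedcafedefcbafcbeca9),
   (14, 12, 0x767654ac377654ac377654374ac97a94acb777754ac3777754ac37777543499ac999999a4acb443aa9b4439b3343aa9b99a39bc33399999ab66575563339b578),
   (14, 8, 0x443665744357334366575563578),
   (12, 14, 0x67678db9e6678db9e6678dedccb92bcdb9a66668db9e66668db9eeeeed86dccb9ccccccbdb9aeedccbaeedcaeedeccbaccbeca9eeecccccba8876887eeeca865),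
   (12, 10, 0xddaa9aaaa9dddd9e8876ddaa9aaaa9dddd9e86dadeeeddadeeedeeaeea9eeeeeea8876887eeeeeea865),
   (12, 2, 0x665aa9d6659d5565aa9d99a59de),
   (8, 14, 0xeedccbaeedcaeedeccbaccbeca9),
   (8, 6, 0xeedccbaeedcaeedeccbaccbeca9),
   (12, 8, 0x67678887886676788878865),
   (8, 12, 0xababcccbccaababcccbcca9),
   (8, 4, 0xababcccbccaababcccbcca9)]

theorem checkStrategy_strategies :
    ∀ r ∈ strategies, (checkStrategy 5 [(15, r.2.1), (0, r.1)] r.2.2).isSome = true := by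
  decide +kernel

/-- The key `2 a_i + b_i` identifies the pair `(a_i, b_i)`, so sorting by it leaves 35 cases. In 13
of them a known vertex is a sink or the two clash; the table covers the other 22. -/
theorem strategies_complete : ∀ a b : Fin 16,
    (∀ i j : Fin 4, i ≤ j → 2 * (bits 4 a i).toNat + (bits 4 b i).toNat ≤
      2 * (bits 4 a j).toNat + (bits 4 b j).toNat) →
    a = 0 ∨ b = 0 ∨ a = b ∨ ∃ r ∈ strategies, r.1 = a ∧ r.2.1 = b := by
  decide +kernel

theorem exists_bits_eq (a : BitString 4) : ∃ x < 16, bits 4 x = a := by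
  revert a
  decide +kernel

theorem bits_injOn : ∀ x < 16, ∀ y < 16, bits 4 x = bits 4 y → x = y := by
  decide +kernel

/-- Which intermediate state `c` occurs is irrelevant: soundness of the checker holds for every
code. -/
theorem exists_of_foldlM_isSome {α β : Type} {f : β → α → Option β} {l : List α} {b : β}
    (h : (l.foldlM f b).isSome = true) : ∀ a ∈ l, ∃ c, (f c a).isSome = true := by
  induction l generalizing b with
  | nil => simp
  | cons x l ih =>
    intro a ha
    rw [List.foldlM_cons] at h
    cases hx : f b x with
    | none => simp [hx] at h
    | some c =>
      rcases List.mem_cons.1 ha with rfl | ha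
      · exact ⟨b, by simp [hx]⟩
      · refine ih (b := c) ?_ a ha
        simpa [hx] using h

/-- The code only suggests which vertices to query. Bounding the vertices by 16 makes `bits 4`
injective on them, so distinct numbers give distinct vertices. -/
theorem reaches_of_checkStrategy {z : BitString 4} {k : ℕ} :
    ∀ {H : List (ℕ × ℕ)} {c : ℕ}, (∀ p ∈ H, p.1 < 16) →
      (checkStrategy k H c).isSome = true →
      Reaches (Settled Finset.univ z) k (H.map (Prod.map (bits 4) (bits 4))) := by
  induction k with
  | zero => simp [checkStrategy]
  | succ k ih =>
    intro H c hH h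
    cases c with
    | zero => simp [checkStrategy] at h
    | succ c =>
      have hv : c % 16 < 16 := Nat.mod_lt _ (by norm_num)
      refine Or.inr ⟨bits 4 (c % 16), fun a => ?_⟩
      obtain ⟨x, hx, rfl⟩ := exists_bits_eq a
      rcases Nat.eq_zero_or_pos x with rfl | hx0
      · exact Reaches.of_goal (fun _ => Or.inl ⟨_, List.mem_cons_self, by simp [face],
          by simp [bits]⟩) k
      obtain ⟨c', hc'⟩ := exists_of_foldlM_isSome h x (List.mem_range'_1.2 (by omega))
      split_ifs at hc' with hcl
      · obtain ⟨p, hp, hpc⟩ := List.any_eq_true.1 hcl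
        simp only [Bool.and_eq_true, bne_iff_ne, ne_eq, beq_iff_eq] at hpc
        refine Reaches.of_goal (fun _ => Or.inr ⟨_, List.mem_cons_self,
          (bits 4 p.1, bits 4 p.2), List.mem_cons_of_mem _ (List.mem_map.2 ⟨p, hp, rfl⟩), fun heq =>
            hpc.1 (bits_injOn _ (hH p hp) _ hv heq.symm), fun i => ?_⟩) k
        have := congrArg (fun m => m.testBit i) hpc.2
        simpa only [bits, Nat.testBit_and, Nat.testBit_xor, Nat.zero_testBit] using this
      · refine ih (H := (c % 16, x) :: H) (fun p hp => ?_) hc'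
        rcases List.mem_cons.1 hp with rfl | hp
        · exact hv
        · exact hH p hp

/-- In dimension four, five queries suffice after those at two antipodal vertices. -/
theorem reaches_of_monotone {z a b : BitString 4}
    (h : Monotone fun i => 2 * (a i).toNat + (b i).toNat) :
    Reaches (Settled Finset.univ z) 5 [(fun _ => true, b), (fun _ => false, a)] := by
  obtain ⟨x, hx, rfl⟩ := exists_bits_eq a
  obtain ⟨y, hy, rfl⟩ := exists_bits_eq b
  have h0 : bits 4 0 = fun _ => false := by funext i; simp [bits]
  have h15 : bits 4 15 = fun _ => true := by decide
  rcases strategies_complete ⟨x, hx⟩ ⟨y, hy⟩ h with hx0 | hy0 | hxy | ⟨r, hr, hrx, hry⟩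
  · obtain rfl : x = 0 := congrArg Fin.val hx0
    exact Reaches.of_goal (fun _ => Or.inl ⟨(fun _ => false, bits 4 0), by simp, by simp [face],
      by simp [bits]⟩) _
  · obtain rfl : y = 0 := congrArg Fin.val hy0
    exact Reaches.of_goal (fun _ => Or.inl ⟨(fun _ => true, bits 4 0), by simp, by simp [face],
      by simp [bits]⟩) _
  · obtain rfl : x = y := congrArg Fin.val hxy
    refine Reaches.of_goal (fun _ => Or.inr ⟨(fun _ => true, bits 4 x), by simp,
      (fun _ => false, bits 4 x), by simp, fun h => ?_, by simp⟩) _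
    simpa using congrFun h 0
  · have := reaches_of_checkStrategy (z := z) (by simp) (checkStrategy_strategies r hr)
    simpa [hrx, hry, h0, h15] using this

-- The improved recursion

theorem t_le_improved_fibonacci
    (hsol : ∀ d : ℕ, ∃ A : QueryAlgorithm d (Answer d), Solves A) (hn : 4 ≤ n) :
    t n ≤ 2 + (∑ k ∈ Finset.range (n - 4), t k) + 5 * t (n - 4) := by
  refine t_le_of_antipodal hsol (z := fun _ => false) (by omega) fun I H hI hA => ?_
  obtain ⟨p, hp, q, hq, hpq, hs⟩ := hA
  have hcard : Iᶜ.card = 4 := by rw [Finset.card_compl, Fintype.card_fin]; omega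
  let e₀ : Fin 4 ↪ Fin n := (Iᶜ.orderEmbOfFin hcard).toEmbedding
  -- Permuting the four free coordinates brings the two known values into the sorted form covered by
  -- the table.
  let σ := Tuple.sort fun j => 2 * (p.2 (e₀ j)).toNat + (q.2 (e₀ j)).toNat
  let e : Fin 4 ↪ Fin n := σ.toEmbedding.trans e₀
  have he₀ : Finset.univ.map e₀ = Iᶜ := by simp [e₀]
  have hmap : Finset.univ.map e = Iᶜ := by
    rw [← Finset.map_map, Finset.map_univ_equiv, he₀]
  have he : ∀ j, e j ∉ I := fun j => by
    rw [← Finset.mem_compl, ← hmap]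
    exact Finset.mem_map_of_mem e (Finset.mem_univ j)
  have hmono : Monotone fun j => 2 * (p.2 (e j)).toNat + (q.2 (e j)).toNat :=
    Tuple.monotone_sort fun j => 2 * (p.2 (e₀ j)).toNat + (q.2 (e₀ j)).toNat
  have hinh : Inherits e I p.1 [(fun _ => true, fun j => q.2 (e j)),
      (fun _ => false, fun j => p.2 (e j))] H := by
    intro r hr
    simp only [List.mem_cons, List.not_mem_nil, or_false] at hr
    rcases hr with rfl | rfl
    · refine ⟨q, hq, fun i hi => ?_, fun i hi => (hs i hi).2, fun _ => rfl⟩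
      obtain ⟨j, -, rfl⟩ := Finset.mem_map.1 (hmap ▸ Finset.mem_compl.2 hi)
      rw [hpq _ hi, shift_apply, Bool.xor_true]
    · exact ⟨p, hp, fun i hi => by simp [shift], fun i hi => (hs i hi).1, fun _ => rfl⟩
  have := Reaches.inherit he (hI ▸ reaches_face hsol I) hinh
    (reaches_of_monotone (z := fun _ => false) hmono)
  rw [hmap, Finset.union_compl, mul_comm] at this
  -- The full face is the whole cube, whatever its base point.
  have huniv : ∀ {x y : BitString n} {H : History n}, Settled Finset.univ x H →
      Settled Finset.univ y H := fun h hc => (h hc).imp_left fun ⟨r, hr, _, hrs⟩ =>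
    ⟨r, hr, by simp [face], hrs⟩
  exact this.bind (l := 0) fun _ _ h => huniv h

-- Correctness and cost of the recursive algorithm

namespace QueryAlgorithm

variable {α β : Type}

theorem output_bind (s : Outmap n) (A : QueryAlgorithm n α) (f : α → QueryAlgorithm n β) :
    (A.bind f).output s = (f (A.output s)).output s := by
  induction A with
  | ret a => rfl
  | query v next ih => exact ih (s v)

theorem queried_bind (s : Outmap n) (A : QueryAlgorithm n α) (f : α → QueryAlgorithm n β) :
    (A.bind f).queried s = A.queried s ++ (f (A.output s)).queried s := by
  induction A with
  | ret a => rfl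
  | query v next ih => exact congrArg (v :: ·) (ih (s v))

end QueryAlgorithm

theorem seesawCost_of_pos {m : ℕ} (hm : 0 < m) :
    seesawCost m = 2 + ∑ k ∈ Finset.range (m - 1), seesawCost k := by
  obtain ⟨m, rfl⟩ : ∃ l, m = l + 1 := ⟨m - 1, by omega⟩
  rw [seesawCost, Finset.sum_range]
  rfl

/-- On `s`, the algorithm returns a sink of the face spanned by `J` at `z`, or a clash in it, it has
queried the vertices of its answer, except for those in `K`, and it makes at most `c` queries. -/
def Finds (s : Outmap n) (J : Finset (Fin n)) (z : BitString n) (K : Set (BitString n)) (c : ℕ)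
    (A : QueryAlgorithm n (Answer n)) : Prop :=
  (A.output s).IsCorrect s J ∧
    (∀ v ∈ (A.output s).vertices, v ∈ face J z ∧ (v ∈ A.queried s ∨ v ∈ K)) ∧
    A.queryCount s ≤ c

theorem finds_ret_sink {s : Outmap n} {J : Finset (Fin n)} {z w a : BitString n}
    {K : Set (BitString n)} {c : ℕ} (hw : w ∈ face J z) (hK : w ∈ K) (ha : s w = a)
    (h : ∀ i ∈ J, a i = false) : Finds s J z K c (.ret (.sink w a)) := by
  subst ha
  refine ⟨⟨rfl, h⟩, ?_, Nat.zero_le c⟩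
  rintro v rfl
  exact ⟨hw, Or.inr hK⟩

theorem finds_ret_clash {s : Outmap n} {J : Finset (Fin n)} {z u v : BitString n}
    {K : Set (BitString n)} {c : ℕ} (hu : u ∈ face J z) (huK : u ∈ K) (hv : v ∈ face J z)
    (hvK : v ∈ K) (h : IsClash s u v) : Finds s J z K c (.ret (.clash u v)) := by
  refine ⟨h, ?_, Nat.zero_le c⟩
  rintro x (rfl | rfl)
  exacts [⟨hu, Or.inr huK⟩, ⟨hv, Or.inr hvK⟩]

theorem Finds.query {s : Outmap n} {J : Finset (Fin n)} {z v : BitString n}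
    {K : Set (BitString n)} {c : ℕ} {next : BitString n → QueryAlgorithm n (Answer n)}
    (h : Finds s J z (insert v K) c (next (s v))) : Finds s J z K (c + 1) (.query v next) := by
  obtain ⟨h1, h2, h3⟩ := h
  refine ⟨h1, fun x hx => ⟨(h2 x hx).1, ?_⟩, Nat.succ_le_succ h3⟩
  rcases (h2 x hx).2 with h | rfl | h
  · exact Or.inl (List.mem_cons_of_mem _ h)
  · exact Or.inl List.mem_cons_self
  · exact Or.inr h

/-- The inner search may name only vertices it has queried itself, so the continuation may count
them as known. -/
theorem Finds.bind {s : Outmap n} {I J : Finset (Fin n)} {y z : BitString n}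
    {K : Set (BitString n)} {c d : ℕ} {A : QueryAlgorithm n (Answer n)}
    {f : Answer n → QueryAlgorithm n (Answer n)} (hA : Finds s I y ∅ c A)
    (hf : ∀ r : Answer n, r.IsCorrect s I → (∀ v ∈ r.vertices, v ∈ face I y) →
      Finds s J z (K ∪ r.vertices) d (f r)) : Finds s J z K (c + d) (A.bind f) := by
  obtain ⟨h1, h2, h3⟩ := hA
  obtain ⟨k1, k2, k3⟩ := hf _ h1 fun v hv => (h2 v hv).1
  unfold Finds QueryAlgorithm.queryCount at *
  rw [QueryAlgorithm.output_bind, QueryAlgorithm.queried_bind]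
  refine ⟨k1, fun v hv => ⟨(k2 v hv).1, ?_⟩, by rw [List.length_append]; omega⟩
  rw [List.mem_append]
  rcases (k2 v hv).2 with h | h | h
  · exact Or.inl (Or.inr h)
  · exact Or.inr h
  · exact Or.inl (Or.inl ((h2 v h).2.resolve_right id))

theorem flip_mem_face {I J : Finset (Fin n)} {v z : BitString n} (hv : v ∈ face J z)
    (hIJ : I ⊆ J) : flip v I ∈ face J z := fun i hi => by
  have hiI : i ∉ I := fun h => hi (hIJ h)
  simp [flip, hiI, hv i hi]

theorem mem_face_trans {I J : Finset (Fin n)} {v y z : BitString n} (hv : v ∈ face I y)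
    (hy : y ∈ face J z) (hIJ : I ⊆ J) : v ∈ face J z := fun i hi => by
  rw [hv i fun h => hi (hIJ h), hy i hi]

/-- The loop invariant: `u` and `v` are sinks of antipodal faces, spanned by `I`, of the face
spanned by `J` at `z`. -/
structure SeesawState (s : Outmap n) (I J : Finset (Fin n)) (z u v : BitString n) : Prop where
  subset : I ⊆ J
  left_mem : u ∈ face J z
  right_mem : v ∈ face J z
  antipodal : ∀ i ∈ J, i ∉ I → v i = !u i
  left_sink : ∀ i ∈ I, s u i = false
  right_sink : ∀ i ∈ I, s v i = false

theorem SeesawState.swap {s : Outmap n} {I J : Finset (Fin n)} {z u v : BitString n}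
    (h : SeesawState s I J z u v) : SeesawState s I J z v u :=
  ⟨h.subset, h.right_mem, h.left_mem, fun i hi hiI => by simp [h.antipodal i hi hiI],
    h.right_sink, h.left_sink⟩

/-- Outmap values agree on `I`, vertices agree outside `J`, and `hs` covers the rest; a coordinate
in `J \ I` keeps `u` and `v` distinct. -/
theorem SeesawState.isClash {s : Outmap n} {I J : Finset (Fin n)} {z u v : BitString n}
    (h : SeesawState s I J z u v) (hIJ : I.card < J.card)
    (hs : ∀ i ∈ J, i ∉ I → ((u i ^^ v i) && (s u i ^^ s v i)) = false) : IsClash s u v := by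
  obtain ⟨j, hj, hjI⟩ := Finset.exists_mem_notMem_of_card_lt_card hIJ
  refine ⟨fun huv => ?_, fun i => ?_⟩
  · have := h.antipodal j hj hjI
    simp [huv] at this
  · by_cases hi : i ∈ J
    · by_cases hiI : i ∈ I
      · simp [h.left_sink i hiI, h.right_sink i hiI]
      · rw [Bool.and_comm]
        exact hs i hi hiI
    · simp [h.left_mem i hi, h.right_mem i hi]

/-- One iteration of the loop, after the swap. -/
theorem SeesawState.finds_step {s : Outmap n} {I J : Finset (Fin n)} {z u v : BitString n}
    {K : Set (BitString n)} {c d : ℕ} {j : Fin n} {A : QueryAlgorithm n (Answer n)}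
    {next : BitString n → BitString n → QueryAlgorithm n (Answer n)}
    (h : SeesawState s I J z u v) (hjJ : j ∈ J) (hjI : j ∉ I) (hvK : v ∈ K)
    (huj : s u j = false) (hvj : s v j = true) (hA : Finds s I (flip v {j}) ∅ c A)
    (hnext : ∀ w, SeesawState s (insert j I) J z u w → Finds s J z (insert w K) d (next w (s w))) :
    Finds s J z K (c + d) (A.bind fun
      | .clash x y => .ret (.clash x y)
      | .sink w a => if a j then .ret (.clash v w) else next w a) := by
  have hface : flip v {j} ∈ face J z :=
    flip_mem_face h.right_mem (Finset.singleton_subset_iff.2 hjJ)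
  refine hA.bind fun r hr hrf => ?_
  cases r with
  | clash x y =>
    exact finds_ret_clash (mem_face_trans (hrf x (Or.inl rfl)) hface h.subset)
      (Or.inr (Or.inl rfl)) (mem_face_trans (hrf y (Or.inr rfl)) hface h.subset)
      (Or.inr (Or.inr rfl)) hr
  | sink w a =>
    obtain ⟨rfl, hs⟩ := hr
    have hwf : w ∈ face I (flip v {j}) := hrf w rfl
    have hwJ : w ∈ face J z := mem_face_trans hwf hface h.subset
    have hwj : w j = !v j := by rw [hwf j hjI]; simp [flip]
    have hw : ∀ i ∉ I, i ≠ j → w i = v i := fun i hi hij => by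
      rw [hwf i hi]; simp [flip, hij]
    dsimp only
    split_ifs with haj
    · refine finds_ret_clash h.right_mem (Or.inl hvK) hwJ (Or.inr rfl) ⟨fun hvw => ?_, fun i => ?_⟩
      · simp [← hvw] at hwj
      · by_cases hi : i ∈ I
        · simp [h.right_sink i hi, hs i hi]
        · rcases eq_or_ne i j with rfl | hij
          · simp [hvj, haj]
          · simp [hw i hi hij]
    · have := hnext w ⟨Finset.insert_subset hjJ h.subset, h.left_mem, hwJ, fun i hi hiI => ?_,
        fun i hi => ?_, fun i hi => ?_⟩
      · rwa [← Set.union_singleton] at this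
      · simp only [Finset.mem_insert, not_or] at hiI
        rw [hw i hiI.2 hiI.1, h.antipodal i hi hiI.2]
      · rcases Finset.mem_insert.1 hi with rfl | hi
        · exact huj
        · exact h.left_sink i hi
      · rcases Finset.mem_insert.1 hi with rfl | hi
        · simpa using haj
        · exact hs i hi

/-- The hypothesis `ih` handles the recursive calls, while an inner induction on `|J| - |I|` follows
the loop. Each pass removes the lowest term of the sum. -/
theorem finds_seesawLoop {s : Outmap n} {J : Finset (Fin n)} {z : BitString n}
    (ih : ∀ (I : Finset (Fin n)) (y : BitString n), I.card < J.card →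
      Finds s I y ∅ (seesawCost I.card) (seesaw I y)) (I : Finset (Fin n)) (u v : BitString n)
    (K : Set (BitString n)) (h : SeesawState s I J z u v) (huK : u ∈ K) (hvK : v ∈ K)
    (hIJ : I.card < J.card) :
    Finds s J z K (∑ k ∈ Finset.Ico I.card (J.card - 1), seesawCost k)
      (seesawLoop J I (u, s u) (v, s v)) := by
  induction hd : J.card - I.card generalizing I u v K with
  | zero => omega
  | succ d ihd =>
    have step : ∀ j ∈ J, j ∉ I → I.card + 1 < J.card → ∀ u v, SeesawState s I J z u v →
        u ∈ K → v ∈ K → s u j = false → s v j = true →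
        Finds s J z K (∑ k ∈ Finset.Ico I.card (J.card - 1), seesawCost k)
          ((seesaw I (flip v {j})).bind fun
            | .clash x y => .ret (.clash x y)
            | .sink w a => if a j then .ret (.clash v w)
              else seesawLoop J (insert j I) (u, s u) (w, a)) := by
      intro j hjJ hjI hI u v h huK hvK huj hvj
      have hcard := Finset.card_insert_of_notMem hjI
      rw [Finset.sum_eq_sum_Ico_succ_bot (by omega)]
      refine h.finds_step hjJ hjI hvK huj hvj (ih I _ hIJ)
        (next := fun w a => seesawLoop J (insert j I) (u, s u) (w, a)) fun w hw => ?_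
      rw [← hcard]
      exact ihd (insert j I) u w _ hw (Or.inr huK) (Or.inl rfl) (by omega) (by omega)
    have hmin : ∀ hD j, ((J \ I).filter fun i =>
        ((u i ^^ v i) && (s u i ^^ s v i)) = true).min' hD = j →
        j ∈ J ∧ j ∉ I ∧ s v j = !s u j := by
      rintro hD j rfl
      obtain ⟨h1, h2⟩ := Finset.mem_filter.1 (Finset.min'_mem _ hD)
      refine ⟨(Finset.mem_sdiff.1 h1).1, (Finset.mem_sdiff.1 h1).2, ?_⟩
      exact Bool.eq_not.2 (Ne.symm (bne_iff_ne.1 (Bool.and_eq_true_iff.1 h2).2))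
    rw [seesawLoop]
    dsimp only
    split_ifs with hI hD huj h1 h2
    · obtain ⟨hjJ, hjI, hne⟩ := hmin hD _ rfl
      exact step _ hjJ hjI hI v u h.swap hvK huK (by rw [hne, huj, Bool.not_true]) huj
    · obtain ⟨hjJ, hjI, hne⟩ := hmin hD _ rfl
      rw [Bool.not_eq_true] at huj
      exact step _ hjJ hjI hI u v h huK hvK huj (by rw [hne, huj, Bool.not_false])
    · refine finds_ret_clash h.left_mem huK h.right_mem hvK (h.isClash hIJ fun i hi hiI => ?_)
      by_contra hne
      exact hD ⟨i, Finset.mem_filter.2 ⟨Finset.mem_sdiff.2 ⟨hi, hiI⟩, by simpa using hne⟩⟩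
    · refine finds_ret_sink h.left_mem huK rfl fun i hi => ?_
      by_cases hiI : i ∈ I
      · exact h.left_sink i hiI
      · exact h1 i (Finset.mem_sdiff.2 ⟨hi, hiI⟩)
    · refine finds_ret_sink h.right_mem hvK rfl fun i hi => ?_
      by_cases hiI : i ∈ I
      · exact h.right_sink i hiI
      · exact h2 i (Finset.mem_sdiff.2 ⟨hi, hiI⟩)
    -- Both values are 1 at the only remaining coordinate, so nothing tells `u` and `v` apart.
    · have hone : (J \ I).card = 1 := by
        rw [Finset.card_sdiff_of_subset h.subset]; omega
      obtain ⟨j, hj⟩ := Finset.card_eq_one.1 hone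
      refine finds_ret_clash h.left_mem huK h.right_mem hvK (h.isClash hIJ fun i hi hiI => ?_)
      obtain rfl : i = j := Finset.mem_singleton.1 (hj ▸ Finset.mem_sdiff.2 ⟨hi, hiI⟩)
      have h1' : s u i = true := by simpa [hj] using h1
      have h2' : s v i = true := by simpa [hj] using h2
      simp [h1', h2']

theorem finds_seesaw (s : Outmap n) (J : Finset (Fin n)) (z : BitString n) :
    Finds s J z ∅ (seesawCost J.card) (seesaw J z) := by
  induction hd : J.card using Nat.strong_induction_on generalizing J z with
  | _ d ih =>
    subst hd
    have hz : z ∈ face J z := fun _ _ => rfl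
    rw [seesaw]
    split_ifs with hJ
    · subst hJ
      have : Finds s ∅ z ∅ (0 + 1) (.query z fun a => .ret (.sink z a)) :=
        Finds.query (finds_ret_sink hz (Or.inl rfl) rfl (by simp))
      simpa [seesawCost] using this
    · have hpos : 0 < J.card := Finset.card_pos.2 (Finset.nonempty_iff_ne_empty.2 hJ)
      have hstate : SeesawState s ∅ J z z (flip z J) :=
        ⟨Finset.empty_subset J, hz, flip_mem_face hz subset_rfl, fun i hi _ => by simp [flip, hi],
          by simp, by simp⟩
      have := finds_seesawLoop (fun I y hI => ih I.card hI I y rfl) ∅ z (flip z J)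
        {flip z J, z} hstate (Or.inr rfl) (Or.inl rfl) (by simpa using hpos)
      rw [seesawCost_of_pos hpos, add_comm]
      refine Finds.query (Finds.query ?_)
      simpa using this

theorem solvesFace_seesaw (J : Finset (Fin n)) (z : BitString n) :
    SolvesFace (seesaw J z) J z := fun s =>
  have h := finds_seesaw s J z
  ⟨h.1, fun v hv => ⟨(h.2.1 v hv).1, (h.2.1 v hv).2.resolve_right id⟩⟩

theorem solves_seesaw (z : BitString n) : Solves (seesaw Finset.univ z) := fun s =>
  have h := solvesFace_seesaw Finset.univ z s
  ⟨h.1, fun v hv => (h.2 v hv).2⟩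

-- Growth rate

/-- Solutions of the recursion of the improved Fibonacci Seesaw grow at rate at most `1.61`. -/
theorem isBigO_of_improved_fibonacci {f : ℕ → ℕ}
    (hf : ∀ n, 4 ≤ n → f n ≤ 2 + (∑ k ∈ Finset.range (n - 4), f k) + 5 * f (n - 4)) :
    (fun n : ℕ => (f n : ℝ)) =O[atTop] fun n : ℕ => (1.61 : ℝ) ^ n := by
  -- The four values cover the base cases; the 2 gives `2 ≤ C / 0.61`, absorbing the additive
  -- constant.
  set C : ℝ := 2 + f 0 + f 1 + f 2 + f 3 with hC
  have hC2 : 2 ≤ C := by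
    have : (0 : ℝ) ≤ f 0 + f 1 + f 2 + f 3 := by positivity
    linarith
  have key : ∀ n, (f n : ℝ) ≤ C * 1.61 ^ n := by
    intro n
    induction n using Nat.strong_induction_on with
    | _ n ih =>
      rcases lt_or_ge n 4 with hn | hn
      · have h1 : (1 : ℝ) ≤ 1.61 ^ n := one_le_pow₀ (by norm_num)
        have h2 : (f n : ℝ) ≤ C := by
          have h0 := fun k => Nat.cast_nonneg (α := ℝ) (f k)
          have := h0 0; have := h0 1; have := h0 2; have := h0 3
          interval_cases n <;> linarith
        nlinarith
      · obtain ⟨m, rfl⟩ := Nat.exists_eq_add_of_le' hn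
        have h := hf (m + 4) hn
        rw [Nat.add_sub_cancel] at h
        have h' : (f (m + 4) : ℝ) ≤ 2 + (∑ k ∈ Finset.range m, (f k : ℝ)) + 5 * f m := by
          exact_mod_cast h
        have hsum : (∑ k ∈ Finset.range m, (f k : ℝ)) ≤ C * ((1.61 ^ m - 1) / (1.61 - 1)) := by
          rw [← geom_sum_eq (by norm_num), Finset.mul_sum]
          exact Finset.sum_le_sum fun k hk => ih k (by have := Finset.mem_range.1 hk; omega)
        have hm := ih m (by omega)
        have hpos : 0 ≤ C * 1.61 ^ m := by positivity
        have e1 : C * ((1.61 ^ m - 1) / (1.61 - 1)) = (C * 1.61 ^ m - C) / 0.61 := by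
          norm_num; ring
        have e2 : C * 1.61 ^ (m + 4) = C * 1.61 ^ m * 1.61 ^ 4 := by ring
        rw [e1] at hsum
        rw [e2]
        norm_num at hsum hm hpos h' ⊢
        -- This works because `1 / 0.61 + 5 < 1.61 ^ 4`.
        linarith
  refine IsBigO.of_bound C (Eventually.of_forall fun n => ?_)
  rw [Real.norm_of_nonneg (by positivity), Real.norm_of_nonneg (by positivity)]
  exact key n

/-- Without a solver in each dimension, `t` would be the infimum of an empty set and the recursions
could not use it as a budget. -/
theorem exists_solves (d : ℕ) : ∃ A : QueryAlgorithm d (Answer d), Solves A :=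
  ⟨_, solves_seesaw fun _ => false⟩

end SinkOrClash

open SinkOrClash
theorem mainTheorem5 :
    -- the adapted Fibonacci Seesaw finds a sink or a clash in any face of any outmap
    (∀ (n : ℕ) (J : Finset (Fin n)) (z : BitString n),
      SolvesFace (seesaw J z) J z ∧
      ∀ s : Outmap n, (seesaw J z).queryCount s ≤ seesawCost J.card) ∧
    (∀ (n : ℕ) (z : BitString n), Solves (seesaw Finset.univ z)) ∧
    -- the resulting recursion and bound
    (∀ n : ℕ, 1 ≤ n → t n ≤ 2 + (∑ k ∈ Finset.range (n - 1), t k)) ∧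
    ((fun n : ℕ => (t n : ℝ)) =O[atTop] fun n : ℕ => (1.62 : ℝ) ^ n) ∧
    -- the recursion of the adapted Improved Fibonacci Seesaw and the resulting bound
    (∀ n : ℕ, 4 ≤ n → t n ≤ 2 + (∑ k ∈ Finset.range (n - 4), t k) + 5 * t (n - 4)) ∧
    ((fun n : ℕ => (t n : ℝ)) =O[atTop] fun n : ℕ => (1.61 : ℝ) ^ n) := by
  have h : (fun n : ℕ => (t n : ℝ)) =O[atTop] fun n : ℕ => (1.61 : ℝ) ^ n :=
    isBigO_of_improved_fibonacci fun n hn => t_le_improved_fibonacci exists_solves hn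
  refine ⟨fun n J z => ⟨solvesFace_seesaw J z, fun s => (finds_seesaw s J z).2.2⟩,
    fun n z => solves_seesaw z, fun n hn => t_le_fibonacci exists_solves hn, ?_,
    fun n hn => t_le_improved_fibonacci exists_solves hn, h⟩
  refine h.trans (IsBigO.of_bound 1 (Eventually.of_forall fun n => ?_))
  rw [one_mul, Real.norm_of_nonneg (by positivity), Real.norm_of_nonneg (by positivity)]
  gcongr
  norm_num
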